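/- Let $f_1,\dots,f_N:\mathbb R^n\to\mathbb R^n$ be locally Lipschitz with $f_i(0)=0$, and put $\mathcal P=\{1,\dots,N\}$. On a probability space $(\Omega,\mathfrak F,\mathsf P)$ let $\sigma=(\sigma(t))_{t\ge 0}$ be a càdlàg $\mathcal P$-valued process with known initial value $\sigma(0)=\sigma_0$, and let $0=\tau_0\le\tau_1\le\tau_2\le\cdots$ be random variables (the switching instants) such that $\sigma(t)=\sigma(\tau_i)$ for $t\in[\tau_i,\tau_{i+1}[$, $i\ge 0$ (at a switching instant the signal is allowed to select the mode it is already in). Consider the randomly switched system $$\dot x=f_\sigma(x),\qquad x(0)=x_0,\qquad t\ge 0,$$ whose solutions are understood in the sense of Carathéodory along almost every sample path of $\sigma$. Assume: (U1) There are continuously differentiable $V_i:\mathbb R^n\to\mathbb R$ ($i\in\mathcal P$), functions $\alpha_1,\alpha_2$ of class $\mathcal K_\infty$ (continuous, strictly increasing, unbounded maps $[0,\infty[\,\to[0,\infty[$ vanishing at $0$), $\mu>1$ and $\lambda_i\in\mathbb R$ such that for all $x\in\mathbb R^n$ and $i,j\in\mathcal P$: $\alpha_1(\|x\|)\le V_i(x)\le\alpha_2(\|x\|)$;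 $\langle\nabla V_i(x),f_i(x)\rangle\le-\lambda_iV_i(x)$; and $V_i(x)\le\mu V_j(x)$. (U2) $\sigma$ is of class UH: the holding times $S_i=\tau_i-\tau_{i-1}$, $i\ge 1$, are i.i.d., uniformly distributed on $[0,T]$ for some $T>0$; there are $q_i\in[0,1]$, $i\in\mathcal P$, such that $\mathsf P\bigl(\sigma(\tau_j)=i\,\big|\,\sigma(\tau_0),\dots,\sigma(\tau_{j-1})\bigr)=q_i$ almost surely for all $j\ge 1$ and $i\in\mathcal P$; and the sequences $(S_i)_{i\ge 1}$ and $(\sigma(\tau_i))_{i\ge 0}$ are independent. (U3) $\displaystyle\sum_{i\in\mathcal P}\frac{\mu q_i\left(1-e^{-\lambda_iT}\right)}{\lambda_iT}<1$, where $(1-e^{-\lambda_iT})/(\lambda_iT)$ is read as its limit $1$ if $\lambda_i=0$. Then for every $x_0\in\mathbb R^n$ there is a solution process $x(\cdot)$ defined on $[0,\infty[$, almost surely unique, with each $x(t)$ a random variable, and the system is $\alpha_1$-globally asymptotically stable in the mean: (SM1) for every $\varepsilon>0$ there is $\delta>0$ such that $\|x_0\|<\delta$ implies $\sup_{t\ge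 0}\mathsf E[\alpha_1(\|x(t)\|)]<\varepsilon$; (SM2) for all $r,\varepsilon'>0$ there is $\widetilde T\ge 0$ such that $\|x_0\|<r$ implies $\sup_{t\ge\widetilde T}\mathsf E[\alpha_1(\|x(t)\|)]<\varepsilon'$. -/

import Mathlib

open MeasureTheory ProbabilityTheory Filter Topology Set
open scoped NNReal ENNReal

noncomputable section

namespace SwitchedSystem

/-- The state space: `ℝⁿ` with the Euclidean norm. -/
abbrev State (n : ℕ) : Type := EuclideanSpace ℝ (Fin n)

/-- Class-`K` functions: continuous, strictly increasing `[0, ∞) → [0, ∞)`, vanishing at `0`. -/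
structure IsClassK (α : ℝ≥0 → ℝ≥0) : Prop where
  continuous : Continuous α
  strictMono : StrictMono α
  map_zero : α 0 = 0

/-- Class-`K_∞` functions: unbounded class-`K` functions. -/
structure IsClassKInf (α : ℝ≥0 → ℝ≥0) : Prop extends IsClassK α where
  tendsto_atTop : Tendsto α atTop atTop

/-- The Lie derivative `⟨∇V(x), f(x)⟩` of `V` along the vector field `f`. -/
def lieDeriv {n : ℕ} (f : State n → State n) (V : State n → ℝ) (x : State n) : ℝ :=
  inner ℝ (gradient V x) (f x)

/-- A family of continuously differentiable Lyapunov-like functions `V i` for the subsystems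
`ẋ = f i (x)`, with class-`K_∞` bounds `α₁`, `α₂`, comparison constant `μ > 1` and rates `lam i`
of arbitrary sign. -/
structure LyapunovFamily {n N : ℕ} (f : Fin N → State n → State n) (V : Fin N → State n → ℝ)
    (α₁ α₂ : ℝ≥0 → ℝ≥0) (μ : ℝ) (lam : Fin N → ℝ) : Prop where
  contDiff : ∀ i, ContDiff ℝ 1 (V i)
  lower_classKInf : IsClassKInf α₁
  upper_classKInf : IsClassKInf α₂
  one_lt : 1 < μ
  lower : ∀ i x, (α₁ ‖x‖₊ : ℝ) ≤ V i x
  upper : ∀ i x, V i x ≤ (α₂ ‖x‖₊ : ℝ)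
  lie_le : ∀ i x, lieDeriv (f i) (V i) x ≤ -lam i * V i x
  compare : ∀ i j x, V i x ≤ μ * V j x

/-- A function of time that is right-continuous on `[0, ∞)` and has left limits on `(0, ∞)`. -/
def IsCadlag {S : Type*} [TopologicalSpace S] (s : ℝ → S) : Prop :=
  (∀ t, 0 ≤ t → ContinuousWithinAt s (Ici t) t) ∧
    ∀ t, 0 < t → ∃ l, Tendsto s (𝓝[<] t) (𝓝 l)

section Signal

variable {Ω : Type*} [MeasurableSpace Ω] {N : ℕ}

/-- `σ` (considered at times `t ≥ 0`) is a càdlàg stochastic process with values in `Fin N` and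
known initial value `σ₀`, with switching instants `0 = τ₀ ≤ τ₁ ≤ τ₂ ≤ ⋯`: the signal is constant
on each `[τᵢ, τᵢ₊₁)`. The value selected at a switching instant is allowed to be the
current one. -/
structure IsSwitchingSignal (σ : ℝ → Ω → Fin N) (τ : ℕ → Ω → ℝ) (σ₀ : Fin N) : Prop where
  measurable_signal : ∀ t, 0 ≤ t → Measurable (σ t)
  cadlag : ∀ ω, IsCadlag (fun t => σ t ω)
  init : ∀ ω, σ 0 ω = σ₀
  measurable_instant : ∀ j, Measurable (τ j)
  instant_zero : ∀ ω, τ 0 ω = 0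
  monotone : ∀ ω, Monotone (fun j => τ j ω)
  const_between : ∀ ω j t, t ∈ Ico (τ j ω) (τ (j + 1) ω) → σ t ω = σ (τ j ω) ω

/-- The holding times; `holdingTime τ j` is `τⱼ₊₁ - τⱼ`, `j ≥ 0`. -/
def holdingTime (τ : ℕ → Ω → ℝ) (j : ℕ) (ω : Ω) : ℝ := τ (j + 1) ω - τ j ω

/-- The mode `σ(τⱼ)` selected at the `j`-th switching instant. -/
def modeAt (σ : ℝ → Ω → Fin N) (τ : ℕ → Ω → ℝ) (j : ℕ) (ω : Ω) : Fin N := σ (τ j ω) ω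

/-- Class UH: i.i.d. holding times, uniformly distributed on `[0, T]`; at each switching
instant the new mode is `i` with conditional probability `q i` given the earlier modes; and the
sequence of holding times is independent of the sequence of modes. -/
structure IsClassUH (P : Measure Ω) (σ : ℝ → Ω → Fin N) (τ : ℕ → Ω → ℝ) (T : ℝ)
    (q : Fin N → ℝ) : Prop where
  T_pos : 0 < T
  indep_holding : iIndepFun (holdingTime τ) P
  uniform_holding : ∀ j, pdf.IsUniform (holdingTime τ j) (Icc 0 T) P volume
  q_mem : ∀ i, q i ∈ Icc (0 : ℝ) 1
  cond_mode : ∀ j, 1 ≤ j → ∀ i,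
    P⟦modeAt σ τ j ⁻¹' {i} | ⨆ k : Fin j, MeasurableSpace.comap (modeAt σ τ k) inferInstance⟧
      =ᵐ[P] fun _ => q i
  indep_seq : IndepFun (fun ω j => holdingTime τ j ω) (fun ω j => modeAt σ τ j ω) P

end Signal

/-- `(1 - e^{-lT}) / (lT)`, with its limit value `1` at `l = 0`. -/
def uniformFactor (l T : ℝ) : ℝ :=
  if l = 0 then 1 else (1 - Real.exp (-l * T)) / (l * T)

/-- `x` is a global Carathéodory solution on `[0, ∞)` of `ẋ(t) = f_{s(t)}(x(t))`, `x(0) = x₀`,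
for a given sample path `s` of the switching signal: `x` is continuous, the right-hand side
along `x` is locally integrable, and `x` satisfies the integral equation (that is, `x` is locally
absolutely continuous and satisfies the differential equation almost everywhere). -/
structure IsSolution {n N : ℕ} (f : Fin N → State n → State n) (s : ℝ → Fin N) (x₀ : State n)
    (x : ℝ → State n) : Prop where
  continuousOn : ContinuousOn x (Ici 0)
  integrable : ∀ t, 0 ≤ t → IntervalIntegrable (fun u => f (s u) (x u)) volume 0 t
  integral_eq : ∀ t, 0 ≤ t → x t = x₀ + ∫ u in (0 : ℝ)..t, f (s u) (x u)

section Stability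

variable {Ω : Type*} [MeasurableSpace Ω] {n N : ℕ}

/-- `X` is a solution process of the switched system started at `x₀`: almost every sample path
is a global solution along the corresponding sample path of `σ`. -/
def IsSolutionProcess (P : Measure Ω) (f : Fin N → State n → State n) (σ : ℝ → Ω → Fin N)
    (x₀ : State n) (X : ℝ → Ω → State n) : Prop :=
  ∀ᵐ ω ∂P, IsSolution f (fun t => σ t ω) x₀ (fun t => X t ω)

/-- For every initial state there is a solution process made of random variables, and for almost
every `ω` its path is the only solution on `[0, ∞)`. -/
def IsWellPosed (P : Measure Ω) (f : Fin N → State n → State n) (σ : ℝ → Ω → Fin N) : Prop :=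
  ∀ x₀ : State n, ∃ X : ℝ → Ω → State n,
    IsSolutionProcess P f σ x₀ X ∧
    (∀ t, 0 ≤ t → AEMeasurable (X t) P) ∧
    ∀ᵐ ω ∂P, ∀ y : ℝ → State n, IsSolution f (fun t => σ t ω) x₀ y →
      EqOn y (fun t => X t ω) (Ici 0)

/-- `E[α(‖ξ‖)]`, as an element of `[0, ∞]`. -/
def meanOf (P : Measure Ω) (α : ℝ≥0 → ℝ≥0) (ξ : Ω → State n) : ℝ≥0∞ :=
  ∫⁻ ω, (α ‖ξ ω‖₊ : ℝ≥0∞) ∂P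

/-- The switched system is `α`-globally asymptotically stable in the mean. -/
structure IsGASMean (P : Measure Ω) (f : Fin N → State n → State n) (σ : ℝ → Ω → Fin N)
    (α : ℝ≥0 → ℝ≥0) : Prop where
  stable : ∀ ε : ℝ, 0 < ε → ∃ δ : ℝ, 0 < δ ∧ ∀ x₀ : State n, ‖x₀‖ < δ →
    ∀ X : ℝ → Ω → State n, IsSolutionProcess P f σ x₀ X →
      (⨆ (t : ℝ) (_ : 0 ≤ t), meanOf P α (X t)) < ENNReal.ofReal ε
  attractive : ∀ r ε : ℝ, 0 < r → 0 < ε → ∃ T : ℝ, 0 ≤ T ∧ ∀ x₀ : State n, ‖x₀‖ < r →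
    ∀ X : ℝ → Ω → State n, IsSolutionProcess P f σ x₀ X →
      (⨆ (t : ℝ) (_ : T ≤ t), meanOf P α (X t)) < ENNReal.ofReal ε

end Stability

end SwitchedSystem

end

/-! Along a sample path, each holding interval multiplies the active Lyapunov function by at most
`exp (-λ S)`, with `λ` the rate of the current mode and `S` the holding time. Each switch costs a
factor `μ`. Hence the value after `j` switches is at most `W j * V (σ 0) x₀`, where `W j` is
`growthFactor` (`IsPathSwitching.lyapunov_le`).

Since the holding times are independent of the modes and of each other, they can be integrated out
first, each leaving the Laplace transform `uniformFactor` of the uniform law. The modes are then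
averaged out one at a time by conditioning (`IsClassUH.lintegral_prod_exp`). So the expectations of
`W (j + 1)` form a geometric sequence whose ratio is the sum assumed to be below one, and `∑ E[W j]`
converges.

The number of switches before `t` is random and correlated with the `W j`, but its joint law is
never needed. Holding times are at most `T`, so it is at least `k` once `k * T ≤ t`, and the
relevant `W j` is dominated by the tail `∑_{j ≥ k} W j` (`exists_meanOf_le`). The full series gives
stability, and its vanishing tails give attractivity.

For well-posedness, the same moment formula with all rates equal to one makes `∑ E[exp (-τ j)]`
finite, so switching instants do not accumulate (`IsClassUH.ae_tendsto_atTop`). The Lyapunov bounds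
then exclude finite escape. The solution is a limit of solutions of cut-off systems, which Picard
iteration makes measurable (`exists_solution_of_cutoff`, `isWellPosed_of_tendsto`). -/

namespace SwitchedSystem

/-! ### Pathwise analysis: uniqueness and Lyapunov estimates along one signal. -/

section Deterministic

variable {n N : ℕ}

/-- A Carathéodory solution has a right derivative wherever the signal is right-continuous. -/
lemma IsSolution.hasDerivWithinAt {g : Fin N → State n → State n} (hg : ∀ i, Continuous (g i))
    {s : ℝ → Fin N} {x₀ : State n} {x : ℝ → State n} (h : IsSolution g s x₀ x) {t : ℝ}
    (ht : 0 ≤ t) (hs : ContinuousWithinAt s (Ici t) t) :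
    HasDerivWithinAt x (g (s t) (x t)) (Ici t) t := by
  have hsub : Ici t ⊆ Ici 0 := Ici_subset_Ici.2 ht
  have hx : ContinuousWithinAt x (Ici t) t := (h.continuousOn t ht).mono hsub
  have hev : ∀ᶠ u in 𝓝[≥] t, s u = s t :=
    hs.eventually (p := fun i => i = s t) (by simp [nhds_discrete])
  have hcont : ContinuousWithinAt (fun u => g (s u) (x u)) (Ici t) t := by
    have h1 : ContinuousWithinAt (fun u => g (s t) (x u)) (Ici t) t :=
      (hg (s t)).continuousAt.comp_continuousWithinAt hx
    refine h1.congr_of_eventuallyEq ?_ rfl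
    filter_upwards [hev] with u hu
    rw [hu]
  have hmeas : StronglyMeasurableAtFilter (fun u => g (s u) (x u)) (𝓝[>] t) := by
    refine AEStronglyMeasurable.stronglyMeasurableAtFilter_of_mem
      (s := Ioc 0 (t + 1)) (h.integrable (t + 1) (by linarith)).1.aestronglyMeasurable ?_
    filter_upwards [Ioc_mem_nhdsGT (show t < t + 1 by linarith)] with u hu
    exact ⟨ht.trans_lt hu.1, hu.2⟩
  have hd := (intervalIntegral.integral_hasDerivWithinAt_right (s := Ici t) (t := Ioi t)
    (h.integrable t ht) hmeas (hcont.mono Ioi_subset_Ici_self)).const_add x₀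
  exact hd.congr (fun u hu => h.integral_eq u (ht.trans hu)) (h.integral_eq t ht)

lemma IsSolution.apply_zero {g : Fin N → State n → State n} {s : ℝ → Fin N} {x₀ : State n}
    {x : ℝ → State n} (h : IsSolution g s x₀ x) : x 0 = x₀ := by
  simpa using h.integral_eq 0 le_rfl

/-- Uniqueness of trajectories of locally Lipschitz switched systems on a bounded interval. -/
lemma eqOn_Icc_of_hasDerivWithinAt {g : Fin N → State n → State n}
    (hg : ∀ i, LocallyLipschitz (g i)) {s : ℝ → Fin N} {x y : ℝ → State n} {b : ℝ}
    (hx : ContinuousOn x (Icc 0 b)) (hy : ContinuousOn y (Icc 0 b))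
    (hx' : ∀ t ∈ Ico 0 b, HasDerivWithinAt x (g (s t) (x t)) (Ici t) t)
    (hy' : ∀ t ∈ Ico 0 b, HasDerivWithinAt y (g (s t) (y t)) (Ici t) t)
    (h0 : x 0 = y 0) : EqOn x y (Icc 0 b) := by
  -- Both trajectories stay in one compact set, where each field is Lipschitz; the sum of the
  -- constants serves every mode at once.
  have hC : IsCompact (x '' Icc 0 b ∪ y '' Icc 0 b) :=
    (isCompact_Icc.image_of_continuousOn hx).union (isCompact_Icc.image_of_continuousOn hy)
  have hK : ∀ i, ∃ K, LipschitzOnWith K (g i) (x '' Icc 0 b ∪ y '' Icc 0 b) := fun i =>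
    (hg i).locallyLipschitzOn.exists_lipschitzOnWith_of_compact hC
  choose K hK using hK
  refine ODE_solution_unique_of_mem_Icc_right (v := fun t => g (s t)) (K := ∑ i, K i)
    (s := fun _ => x '' Icc 0 b ∪ y '' Icc 0 b) (fun t _ => (hK (s t)).weaken ?_) hx hx'
    (fun t ht => Or.inl (mem_image_of_mem x (Ico_subset_Icc_self ht))) hy hy'
    (fun t ht => Or.inr (mem_image_of_mem y (Ico_subset_Icc_self ht))) h0
  exact Finset.single_le_sum (f := K) (fun _ _ => zero_le) (Finset.mem_univ (s t))

/-- Exponential estimate for a Lyapunov-like function along a trajectory of one subsystem. -/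
lemma lyapunov_le_exp {g : State n → State n} {W : State n → ℝ} (hW : Differentiable ℝ W)
    {l : ℝ} (hlie : ∀ z, lieDeriv g W z ≤ -l * W z) {x : ℝ → State n} {a b : ℝ}
    (hx : ContinuousOn x (Icc a b))
    (hx' : ∀ t ∈ Ico a b, HasDerivWithinAt x (g (x t)) (Ici t) t) {t : ℝ} (ht : t ∈ Icc a b) :
    W (x t) ≤ Real.exp (-l * (t - a)) * W (x a) := by
  have hd : ∀ t ∈ Ico a b, HasDerivWithinAt (fun u => W (x u)) (lieDeriv g W (x t)) (Ici t) t := by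
    intro t ht
    have h1 := (hW (x t)).hasFDerivAt.comp_hasDerivWithinAt t (hx' t ht)
    rwa [← toDual_gradient, InnerProductSpace.toDual_apply_apply] at h1
  have h := le_gronwallBound_of_liminf_deriv_right_le (f := fun u => W (x u))
    (f' := fun u => lieDeriv g W (x u)) (δ := W (x a)) (K := -l) (ε := 0)
    (hW.continuous.comp_continuousOn hx)
    (fun u hu r hr => (hd u hu).liminf_right_slope_le hr) le_rfl
    (fun u _ => by simpa using hlie (x u)) t ht
  rw [gronwallBound_ε0] at h
  linarith

/-- Switching instants `0 = r₀ ≤ r₁ ≤ ⋯` of a signal `s` that is constant in between. -/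
structure IsPathSwitching (s : ℝ → Fin N) (r : ℕ → ℝ) : Prop where
  zero : r 0 = 0
  mono : Monotone r
  const : ∀ j, ∀ t ∈ Ico (r j) (r (j + 1)), s t = s (r j)

lemma IsPathSwitching.nonneg {s : ℝ → Fin N} {r : ℕ → ℝ} (h : IsPathSwitching s r) (j : ℕ) :
    0 ≤ r j := h.zero ▸ h.mono (Nat.zero_le j)

/-- Every time lies in some interval between consecutive switching instants. -/
lemma IsPathSwitching.exists_mem_Ico {s : ℝ → Fin N} {r : ℕ → ℝ} (h : IsPathSwitching s r)
    (htop : Tendsto r atTop atTop) {t : ℝ} (ht : 0 ≤ t) : ∃ j, t ∈ Ico (r j) (r (j + 1)) := by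
  classical
  have hex : ∃ j, t < r j := (htop.eventually_gt_atTop t).exists
  obtain ⟨k, hk⟩ : ∃ k, Nat.find hex = k + 1 := by
    refine Nat.exists_eq_succ_of_ne_zero fun h0 => ?_
    have := Nat.find_spec hex
    rw [h0, h.zero] at this
    linarith
  refine ⟨k, not_lt.1 (Nat.find_min hex (m := k) (by omega)), ?_⟩
  have := Nat.find_spec hex
  rwa [hk] at this

lemma IsPathSwitching.continuousWithinAt {s : ℝ → Fin N} {r : ℕ → ℝ} (h : IsPathSwitching s r)
    (htop : Tendsto r atTop atTop) {t : ℝ} (ht : 0 ≤ t) : ContinuousWithinAt s (Ici t) t := by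
  obtain ⟨j, hj⟩ := h.exists_mem_Ico htop ht
  refine (continuousWithinAt_const (b := s t)).congr_of_eventuallyEq ?_ rfl
  filter_upwards [Ico_mem_nhdsGE hj.2] with u hu
  rw [h.const j u ⟨hj.1.trans hu.1, hu.2⟩, h.const j t hj]

/-- The accumulated growth factor after `j` switches of the upper bound for the Lyapunov-like
functions along a trajectory. -/
noncomputable def growthFactor (μ : ℝ) (lam : Fin N → ℝ) (s : ℝ → Fin N) (r : ℕ → ℝ) (j : ℕ) : ℝ :=
  μ ^ j * ∏ k ∈ Finset.range j, Real.exp (-lam (s (r k)) * (r (k + 1) - r k))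

/-- Upper bound for multiple Lyapunov-like functions along a trajectory. -/
lemma IsPathSwitching.lyapunov_le {s : ℝ → Fin N} {r : ℕ → ℝ} (h : IsPathSwitching s r)
    {g : Fin N → State n → State n} {V : Fin N → State n → ℝ} (hV : ∀ i, Differentiable ℝ (V i))
    {lam : Fin N → ℝ} (hlie : ∀ i z, lieDeriv (g i) (V i) z ≤ -lam i * V i z)
    {μ : ℝ} (hμ : 0 ≤ μ) (hcomp : ∀ i j z, V i z ≤ μ * V j z) {x : ℝ → State n}
    (hx : ContinuousOn x (Ici 0))
    (hx' : ∀ t, 0 ≤ t → HasDerivWithinAt x (g (s t) (x t)) (Ici t) t) (j : ℕ) :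
    ∀ t ∈ Icc (r j) (r (j + 1)), V (s (r j)) (x t) ≤
      Real.exp (-lam (s (r j)) * (t - r j)) * (growthFactor μ lam s r j * V (s 0) (x 0)) := by
  -- The right endpoint is included because the estimate is handed over to the next mode there.
  have hstep : ∀ j, ∀ t ∈ Icc (r j) (r (j + 1)), V (s (r j)) (x t) ≤
      Real.exp (-lam (s (r j)) * (t - r j)) * V (s (r j)) (x (r j)) := by
    intro j t ht
    refine lyapunov_le_exp (hV _) (hlie _) (hx.mono fun u hu => (h.nonneg j).trans hu.1) ?_ ht
    intro u hu
    have := hx' u ((h.nonneg j).trans hu.1)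
    rwa [h.const j u hu] at this
  have key : V (s (r j)) (x (r j)) ≤ growthFactor μ lam s r j * V (s 0) (x 0) := by
    induction j with
    | zero => simp [growthFactor, h.zero]
    | succ j ih =>
      calc V (s (r (j + 1))) (x (r (j + 1))) ≤ μ * V (s (r j)) (x (r (j + 1))) := hcomp _ _ _
        _ ≤ μ * (Real.exp (-lam (s (r j)) * (r (j + 1) - r j)) *
              (growthFactor μ lam s r j * V (s 0) (x 0))) := by
            gcongr
            exact (hstep j _ ⟨h.mono j.le_succ, le_rfl⟩).trans (by gcongr)
        _ = growthFactor μ lam s r (j + 1) * V (s 0) (x 0) := by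
            rw [growthFactor, growthFactor, Finset.prod_range_succ, pow_succ]
            ring
  exact fun t ht => (hstep j t ht).trans (by gcongr)

end Deterministic

/-! ### Cutting off the vector fields. -/

section Truncation

variable {n N : ℕ}

/-- A Lipschitz cutoff function, equal to `1` on the closed ball of radius `R` and to `0` outside
the ball of radius `R + 1`. -/
noncomputable def cutoff (R : ℝ) (x : State n) : ℝ := max 0 (min 1 (R + 1 - ‖x‖))

lemma continuous_cutoff (R : ℝ) : Continuous (cutoff R : State n → ℝ) := by
  unfold cutoff
  fun_prop

lemma cutoff_nonneg (R : ℝ) (x : State n) : 0 ≤ cutoff R x := le_max_left _ _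

lemma cutoff_le_one (R : ℝ) (x : State n) : cutoff R x ≤ 1 := max_le zero_le_one (min_le_left _ _)

lemma cutoff_eq_one {R : ℝ} {x : State n} (h : ‖x‖ ≤ R) : cutoff R x = 1 := by
  rw [cutoff, min_eq_left (by linarith), max_eq_right zero_le_one]

lemma cutoff_eq_zero {R : ℝ} {x : State n} (h : R + 1 ≤ ‖x‖) : cutoff R x = 0 := by
  rw [cutoff, max_eq_left]
  exact (min_le_right _ _).trans (by linarith)

lemma abs_cutoff_sub_le (R : ℝ) (x y : State n) : |cutoff R x - cutoff R y| ≤ ‖x - y‖ := by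
  have h1 := abs_max_sub_max_le_abs (min 1 (R + 1 - ‖x‖)) (min 1 (R + 1 - ‖y‖)) 0
  have h2 := abs_min_sub_min_le_max 1 (R + 1 - ‖x‖) 1 (R + 1 - ‖y‖)
  have h3 : |R + 1 - ‖x‖ - (R + 1 - ‖y‖)| ≤ ‖x - y‖ := by
    rw [show R + 1 - ‖x‖ - (R + 1 - ‖y‖) = -(‖x‖ - ‖y‖) by ring, abs_neg]
    exact abs_norm_sub_norm_le x y
  rw [sub_self, abs_zero, max_eq_right (abs_nonneg _)] at h2
  rw [cutoff, cutoff, max_comm 0, max_comm 0]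
  exact h1.trans (h2.trans h3)

/-- Cutting off a locally Lipschitz vector field makes it bounded and globally Lipschitz. -/
lemma exists_lipschitz_cutoff_smul {f : State n → State n} (hf : LocallyLipschitz f) (R : ℝ) :
    ∃ K C : ℝ, 0 ≤ K ∧ 0 ≤ C ∧ (∀ x, ‖cutoff R x • f x‖ ≤ C) ∧
      ∀ x y, ‖cutoff R x • f x - cutoff R y • f y‖ ≤ K * ‖x - y‖ := by
  have hB : IsCompact (Metric.closedBall (0 : State n) (R + 1)) := isCompact_closedBall _ _
  obtain ⟨K, hK⟩ := hf.locallyLipschitzOn.exists_lipschitzOnWith_of_compact hB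
  obtain ⟨M, hM⟩ := hB.exists_bound_of_continuousOn hf.continuous.continuousOn
  have hM' : ∀ x : State n, ‖x‖ ≤ R + 1 → ‖f x‖ ≤ max M 0 := fun x hx =>
    (hM x (by simpa using hx)).trans (le_max_left _ _)
  have hM0 : 0 ≤ max M 0 := le_max_right _ _
  -- Outside the ball `f y` is uncontrolled, but the cutoff vanishes at `y`, so `cutoff R x` is
  -- itself at most `‖x - y‖`.
  have hout : ∀ x y : State n, R + 1 < ‖y‖ →
      ‖cutoff R x • f x - cutoff R y • f y‖ ≤ (K + max M 0) * ‖x - y‖ := by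
    intro x y hy
    rcases le_or_gt ‖x‖ (R + 1) with hx | hx
    · have h1 := abs_cutoff_sub_le R x y
      rw [cutoff_eq_zero hy.le, sub_zero] at h1
      rw [cutoff_eq_zero hy.le, zero_smul, sub_zero, norm_smul, Real.norm_eq_abs]
      calc _ ≤ ‖x - y‖ * max M 0 := by gcongr; exact hM' x hx
        _ ≤ (K + max M 0) * ‖x - y‖ := by nlinarith [norm_nonneg (x - y), K.2]
    · rw [cutoff_eq_zero hy.le, cutoff_eq_zero hx.le, zero_smul, zero_smul, sub_zero, norm_zero]
      positivity
  refine ⟨K + max M 0, max M 0, by positivity, hM0, fun x => ?_, fun x y => ?_⟩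
  · rcases le_or_gt ‖x‖ (R + 1) with hx | hx
    · rw [norm_smul, Real.norm_of_nonneg (cutoff_nonneg R x)]
      exact (mul_le_of_le_one_left (norm_nonneg _) (cutoff_le_one R x)).trans (hM' x hx)
    · simp [cutoff_eq_zero hx.le]
  · rcases le_or_gt ‖y‖ (R + 1) with hy | hy
    · rcases le_or_gt ‖x‖ (R + 1) with hx | hx
      · have h1 : ‖f x - f y‖ ≤ K * ‖x - y‖ := by
          simpa [dist_eq_norm] using hK.dist_le_mul x (by simpa using hx) y (by simpa using hy)
        have h2 := abs_cutoff_sub_le R x y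
        have h3 := hM' y hy
        calc ‖cutoff R x • f x - cutoff R y • f y‖
            = ‖cutoff R x • (f x - f y) + (cutoff R x - cutoff R y) • f y‖ := by
              congr 1; rw [smul_sub, sub_smul]; abel
          _ ≤ cutoff R x * ‖f x - f y‖ + |cutoff R x - cutoff R y| * ‖f y‖ := by
              refine (norm_add_le _ _).trans ?_
              rw [norm_smul, norm_smul, Real.norm_of_nonneg (cutoff_nonneg R x), Real.norm_eq_abs]
          _ ≤ 1 * (K * ‖x - y‖) + ‖x - y‖ * max M 0 := by
              gcongr
              exact cutoff_le_one R x
          _ = (K + max M 0) * ‖x - y‖ := by ring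
      · rw [norm_sub_rev, norm_sub_rev x]
        exact hout y x hx
    · exact hout x y hy

/-- The cutoff rescales the Lie derivative by a factor in `[0, 1]`. Decay is lost, but the growth
rate `L` does not depend on `R`, which is what excludes finite escape. -/
lemma lieDeriv_cutoff_smul_le {f : State n → State n} {W : State n → ℝ} {l L : ℝ} (hL : |l| ≤ L)
    (hW : ∀ z, 0 ≤ W z) (h : ∀ z, lieDeriv f W z ≤ -l * W z) (R : ℝ) (z : State n) :
    lieDeriv (fun y => cutoff R y • f y) W z ≤ L * W z := by
  have h1 : lieDeriv f W z ≤ L * W z := (h z).trans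
    (mul_le_mul_of_nonneg_right ((neg_le_abs l).trans hL) (hW z))
  have h2 : 0 ≤ L * W z := mul_nonneg ((abs_nonneg l).trans hL) (hW z)
  have h3 : lieDeriv (fun y => cutoff R y • f y) W z = cutoff R z * lieDeriv f W z := by
    rw [lieDeriv, lieDeriv, inner_smul_right]
  rw [h3]
  calc _ ≤ cutoff R z * (L * W z) := by gcongr; exact cutoff_nonneg R z
    _ ≤ L * W z := mul_le_of_le_one_left h2 (cutoff_le_one R z)

end Truncation

/-! ### Jointly measurable solutions by Picard iteration. -/

section Picard

variable {Ω : Type*} [MeasurableSpace Ω] {n N : ℕ}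

/-- Picard iterates for a randomly switched system; constant for negative times. -/
noncomputable def picardIter (g : Fin N → State n → State n) (s : ℝ → Ω → Fin N) (x₀ : State n) :
    ℕ → ℝ → Ω → State n
  | 0, _, _ => x₀
  | k + 1, t, ω => x₀ + ∫ u in Ioc 0 t, g (s u ω) (picardIter g s x₀ k u ω)

lemma measurable_switched {g : Fin N → State n → State n} (hg : ∀ i, Continuous (g i))
    {α : Type*} [MeasurableSpace α] {s : α → Fin N} (hs : Measurable s) {x : α → State n}
    (hx : Measurable x) : Measurable fun a => g (s a) (x a) :=
  (measurable_from_prod_countable_right (f := fun p : Fin N × State n => g p.1 p.2)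
    fun i => (hg i).measurable).comp (hs.prodMk hx)

lemma measurable_picardIter {g : Fin N → State n → State n} (hg : ∀ i, Continuous (g i))
    {s : ℝ → Ω → Fin N} (hs : Measurable fun p : ℝ × Ω => s p.1 p.2) (x₀ : State n) (k : ℕ) :
    Measurable fun p : ℝ × Ω => picardIter g s x₀ k p.1 p.2 := by
  induction k with
  | zero => exact measurable_const
  | succ k ih =>
    have hm : Measurable fun p : (ℝ × Ω) × ℝ => g (s p.2 p.1.2) (picardIter g s x₀ k p.2 p.1.2) :=
      (measurable_switched hg hs ih).comp
        (measurable_snd.prodMk (measurable_snd.comp measurable_fst))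
    -- The variable domain of integration becomes an indicator in `((t, ω), u)`, so that a
    -- parametric integral over all of `ℝ` remains.
    have hS : MeasurableSet {p : (ℝ × Ω) × ℝ | p.2 ∈ Ioc 0 p.1.1} :=
      (measurableSet_lt measurable_const measurable_snd).inter
        (measurableSet_le measurable_snd (measurable_fst.comp measurable_fst))
    have := (hm.indicator hS).stronglyMeasurable.integral_prod_right' (ν := volume)
    convert measurable_const.add this.measurable using 2 with p
    rw [picardIter, ← integral_indicator measurableSet_Ioc]
    rfl

/-- Global solutions of switched systems with bounded Lipschitz vector fields, jointly measurable
in time and in the random parameter. -/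
lemma exists_measurable_solution {g : Fin N → State n → State n} {K C : ℝ} (hK : 0 ≤ K)
    (hC : 0 ≤ C) (hgC : ∀ i x, ‖g i x‖ ≤ C) (hgK : ∀ i x y, ‖g i x - g i y‖ ≤ K * ‖x - y‖)
    {s : ℝ → Ω → Fin N} (hs : Measurable fun p : ℝ × Ω => s p.1 p.2) (x₀ : State n) :
    ∃ y : ℝ → Ω → State n, (∀ t, Measurable (y t)) ∧
      ∀ ω, IsSolution g (fun t => s t ω) x₀ (fun t => y t ω) := by
  have hg : ∀ i, Continuous (g i) := fun i =>
    (LipschitzWith.of_dist_le_mul (K := ⟨K, hK⟩)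
      (fun x y => by rw [dist_eq_norm, dist_eq_norm]; exact hgK i x y)).continuous
  set p := picardIter g s x₀ with hp
  have hpm : ∀ k, Measurable fun q : ℝ × Ω => p k q.1 q.2 := measurable_picardIter hg hs x₀
  have hgm : ∀ k ω, Measurable fun u => g (s u ω) (p k u ω) := fun k ω =>
    (measurable_switched hg hs (hpm k)).comp (measurable_id.prodMk measurable_const)
  have hint : ∀ {φ : ℝ → State n} (t : ℝ), Measurable φ → (∀ u, ‖φ u‖ ≤ C) →
      IntegrableOn φ (Ioc 0 t) := fun {φ} t hφ hb =>
    Measure.integrableOn_of_bounded (M := C) (by simp) hφ.aestronglyMeasurable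
      (Eventually.of_forall hb)
  have hstep : ∀ k ω t, 0 ≤ t → ‖p (k + 1) t ω - p k t ω‖ ≤
      C * t * ((K * t) ^ k / k.factorial) := by
    intro k ω
    induction k with
    | zero =>
      intro t ht
      have h1 : p 1 t ω - p 0 t ω = ∫ u in Ioc 0 t, g (s u ω) (p 0 u ω) := by
        simp [hp, picardIter]
      rw [h1]
      refine (norm_setIntegral_le_of_norm_le_const (C := C) (by simp) fun u _ => hgC _ _).trans ?_
      simp [ht]
    | succ k ih =>
      intro t ht
      have h1 : p (k + 2) t ω - p (k + 1) t ω =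
          ∫ u in Ioc 0 t, (g (s u ω) (p (k + 1) u ω) - g (s u ω) (p k u ω)) := by
        rw [integral_sub (hint t (hgm _ _) fun u => hgC _ _) (hint t (hgm _ _) fun u => hgC _ _)]
        simp [hp, picardIter]
      rw [h1]
      -- The factor `C * t` is frozen at the outer time, leaving a pure power of `u` to integrate;
      -- this costs only a sharper factorial.
      have hcont : Continuous fun u : ℝ => K * (C * t * ((K * u) ^ k / k.factorial)) := by fun_prop
      refine (norm_integral_le_of_norm_le (g := fun u => K * (C * t * ((K * u) ^ k / k.factorial)))
        (hcont.integrableOn_Ioc) ?_).trans ?_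
      · filter_upwards [ae_restrict_mem measurableSet_Ioc] with u hu
        refine (hgK _ _ _).trans ?_
        gcongr
        have hu0 := hu.1.le
        refine (ih u hu0).trans ?_
        gcongr
        exact hu.2
      · rw [← intervalIntegral.integral_of_le ht]
        have : ∀ u : ℝ, K * (C * t * ((K * u) ^ k / k.factorial)) =
            (K * (C * t * (K ^ k / k.factorial))) * u ^ k := fun u => by rw [mul_pow]; ring
        simp_rw [this]
        rw [intervalIntegral.integral_const_mul, integral_pow, Nat.factorial_succ, mul_pow]
        have : (k.factorial : ℝ) ≠ 0 := by positivity
        apply le_of_eq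
        push_cast
        field_simp
        ring
  have hlim : ∀ t ω, ∃ l, Tendsto (fun k => p k t ω) atTop (𝓝 l) := by
    intro t ω
    rcases le_or_gt 0 t with ht | ht
    · refine cauchySeq_tendsto_of_complete (cauchySeq_of_dist_le_of_summable _ (fun k => ?_)
        ((Real.summable_pow_div_factorial (K * t)).mul_left (C * t)))
      rw [dist_comm, dist_eq_norm]
      exact hstep k ω t ht
    -- For negative times the integration domain is empty and every iterate is `x₀`, so the limit
    -- exists on all of `ℝ × Ω`.
    · refine ⟨x₀, tendsto_const_nhds.congr fun k => ?_⟩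
      cases k with
      | zero => rfl
      | succ k => simp [hp, picardIter, Ioc_eq_empty_of_le ht.le]
  choose y hy using hlim
  have hym : Measurable fun q : ℝ × Ω => y q.1 q.2 :=
    measurable_of_tendsto_metrizable hpm (tendsto_pi_nhds.2 fun q => hy q.1 q.2)
  have hgy : ∀ ω, Measurable fun u => g (s u ω) (y u ω) := fun ω =>
    (measurable_switched hg hs hym).comp (measurable_id.prodMk measurable_const)
  have hgyi : ∀ ω a b, IntervalIntegrable (fun u => g (s u ω) (y u ω)) volume a b := fun ω a b =>
    (intervalIntegrable_const (c := C)).mono_fun' (hgy ω).aestronglyMeasurable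
      (Eventually.of_forall fun u => hgC _ _)
  have heq : ∀ ω t, 0 ≤ t → y t ω = x₀ + ∫ u in (0 : ℝ)..t, g (s u ω) (y u ω) := by
    intro ω t ht
    refine tendsto_nhds_unique ((hy t ω).comp (tendsto_add_atTop_nat 1)) ?_
    rw [intervalIntegral.integral_of_le ht]
    refine tendsto_const_nhds.add ?_
    exact tendsto_integral_of_dominated_convergence (fun _ => C)
      (fun k => (hgm k ω).aestronglyMeasurable) (by simp)
      (fun k => Eventually.of_forall fun u => hgC _ _)
      (Eventually.of_forall fun u => ((hg _).tendsto _).comp (hy u ω))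
  refine ⟨y, fun t => hym.comp (measurable_const.prodMk measurable_id), fun ω => ⟨?_, ?_, heq ω⟩⟩
  · refine ContinuousOn.congr (Continuous.continuousOn ?_) (fun t ht => heq ω t ht)
    exact continuous_const.add (intervalIntegral.continuous_primitive (hgyi ω) 0)
  · exact fun t _ => hgyi ω 0 t

end Picard

/-! ### Existence, uniqueness and measurability for the random system. -/

section WellPosed

variable {Ω : Type*} [MeasurableSpace Ω] {n N : ℕ}

/-- Allows `σ (max t 0)`, which is jointly measurable on `ℝ × Ω`, to stand in for `σ`, about which
nothing is known at negative times. -/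
lemma IsSolution.congr_signal {g : Fin N → State n → State n} {s s' : ℝ → Fin N} {x₀ : State n}
    {x : ℝ → State n} (h : IsSolution g s x₀ x) (hs : ∀ t, 0 ≤ t → s t = s' t) :
    IsSolution g s' x₀ x := by
  have huIoc : ∀ t, 0 ≤ t → ∀ u ∈ uIoc 0 t, g (s u) (x u) = g (s' u) (x u) := by
    intro t ht u hu
    rw [uIoc_of_le ht] at hu
    rw [hs u hu.1.le]
  refine ⟨h.continuousOn, fun t ht => (h.integrable t ht).congr (huIoc t ht),
    fun t ht => (h.integral_eq t ht).trans ?_⟩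
  congr 1
  exact intervalIntegral.integral_congr_ae (Eventually.of_forall (huIoc t ht))

lemma LyapunovFamily.nonneg {f : Fin N → State n → State n} {V : Fin N → State n → ℝ}
    {α₁ α₂ : ℝ≥0 → ℝ≥0} {μ : ℝ} {lam : Fin N → ℝ} (hV : LyapunovFamily f V α₁ α₂ μ lam)
    (i : Fin N) (x : State n) : 0 ≤ V i x := (NNReal.coe_nonneg _).trans (hV.lower i x)

lemma LyapunovFamily.differentiable {f : Fin N → State n → State n} {V : Fin N → State n → ℝ}
    {α₁ α₂ : ℝ≥0 → ℝ≥0} {μ : ℝ} {lam : Fin N → ℝ} (hV : LyapunovFamily f V α₁ α₂ μ lam)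
    (i : Fin N) : Differentiable ℝ (V i) := (hV.contDiff i).differentiable one_ne_zero

/-- A bound, uniform in the cutoff radius, for solutions of the cut-off systems. -/
lemma exists_norm_le_of_cutoff {f : Fin N → State n → State n}
    (hf : ∀ i, LocallyLipschitz (f i)) {V : Fin N → State n → ℝ}
    {α₁ α₂ : ℝ≥0 → ℝ≥0} {μ : ℝ} {lam : Fin N → ℝ} (hV : LyapunovFamily f V α₁ α₂ μ lam)
    {s : ℝ → Fin N} {r : ℕ → ℝ} (h : IsPathSwitching s r) (htop : Tendsto r atTop atTop)
    (x₀ : State n) (b : ℝ) : ∃ ρ : ℝ, ∀ (R : ℝ) (x : ℝ → State n),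
      IsSolution (fun i z => cutoff R z • f i z) s x₀ x → ∀ t ∈ Icc 0 b, ‖x t‖ ≤ ρ := by
  set L := ∑ i, |lam i|
  have hL : ∀ i, |lam i| ≤ L := fun i =>
    Finset.single_le_sum (f := fun i => |lam i|) (fun _ _ => abs_nonneg _) (Finset.mem_univ i)
  have hμ : 0 ≤ μ := zero_le_one.trans hV.one_lt.le
  -- At most `J` switches occur before `b`, and with all rates replaced by `-L` the exponentials
  -- telescope. As `1 < μ`, the bound `B` covers every `j ≤ J` and is independent of `R`;
  -- unboundedness of `α₁` turns it into a norm bound.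
  obtain ⟨J, hJ⟩ := (htop.eventually_gt_atTop b).exists
  set B := Real.exp (L * b) * (μ ^ J * V (s 0) x₀)
  obtain ⟨ρ, hρ⟩ := (hV.lower_classKInf.tendsto_atTop.eventually_gt_atTop B.toNNReal).exists
  refine ⟨ρ, fun R x hx t ht => ?_⟩
  obtain ⟨j, hj⟩ := h.exists_mem_Ico htop ht.1
  have hjJ : j ≤ J := by
    by_contra hlt
    exact absurd (h.mono (not_le.1 hlt).le) (not_le.2 (hj.1.trans_lt (ht.2.trans_lt hJ)))
  have hg : ∀ i, Continuous fun z => cutoff R z • f i z := fun i =>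
    (continuous_cutoff R).smul (hf i).continuous
  have hbound := h.lyapunov_le (g := fun i z => cutoff R z • f i z) hV.differentiable
    (lam := fun _ => -L)
    (fun i z => by simpa using lieDeriv_cutoff_smul_le (hL i) (hV.nonneg i) (hV.lie_le i) R z)
    hμ hV.compare hx.continuousOn
    (fun u hu => hx.hasDerivWithinAt hg hu (h.continuousWithinAt htop hu)) j t
    (Ico_subset_Icc_self hj)
  have hgrow : growthFactor μ (fun _ : Fin N => -L) s r j = μ ^ j * Real.exp (L * r j) := by
    rw [growthFactor, ← Real.exp_sum]
    simp_rw [neg_neg]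
    rw [← Finset.mul_sum, Finset.sum_range_sub, h.zero, sub_zero]
  have hVB : V (s (r j)) (x t) ≤ B := by
    rw [hgrow, hx.apply_zero, neg_neg] at hbound
    calc _ ≤ _ := hbound
      _ = Real.exp (L * t) * (μ ^ j * V (s 0) x₀) := by
        rw [show L * t = L * (t - r j) + L * r j by ring, Real.exp_add]; ring
      _ ≤ B := by
        have := hV.nonneg (s 0) x₀
        have := hV.one_lt.le
        change _ ≤ Real.exp (L * b) * (μ ^ J * V (s 0) x₀)
        gcongr
        exact ht.2
  have hα : α₁ ‖x t‖₊ < α₁ ρ := by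
    refine lt_of_le_of_lt ?_ hρ
    rw [Real.le_toNNReal_iff_coe_le ((hV.nonneg _ _).trans hVB)]
    exact (hV.lower _ _).trans hVB
  exact_mod_cast (hV.lower_classKInf.strictMono.lt_iff_lt.1 hα).le

/-- The solutions of the cut-off systems converge, as the radius grows, to the unique solution of
the switched system. -/
lemma exists_solution_of_cutoff {f : Fin N → State n → State n}
    (hf : ∀ i, LocallyLipschitz (f i)) {V : Fin N → State n → ℝ}
    {α₁ α₂ : ℝ≥0 → ℝ≥0} {μ : ℝ} {lam : Fin N → ℝ} (hV : LyapunovFamily f V α₁ α₂ μ lam)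
    {s : ℝ → Fin N} {r : ℕ → ℝ} (h : IsPathSwitching s r) (htop : Tendsto r atTop atTop)
    (x₀ : State n) {y : ℕ → ℝ → State n}
    (hy : ∀ R : ℕ, IsSolution (fun i z => cutoff R z • f i z) s x₀ (y R)) :
    ∃ x : ℝ → State n, IsSolution f s x₀ x ∧
      ∀ t, 0 ≤ t → Tendsto (fun R => y R t) atTop (𝓝 (x t)) := by
  choose ρ hρ using exists_norm_le_of_cutoff hf hV h htop x₀
  have hg : ∀ (R : ℕ) i, Continuous fun z => cutoff R z • f i z := fun R i =>
    (continuous_cutoff R).smul (hf i).continuous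
  have hcut : ∀ b, ∀ R : ℕ, ⌈ρ b⌉₊ ≤ R → ∀ t ∈ Icc 0 b, cutoff (R : ℝ) (y R t) = 1 :=
    fun b R hR t ht =>
    cutoff_eq_one ((hρ b R _ (hy R) t ht).trans ((Nat.le_ceil _).trans (by exact_mod_cast hR)))
  have hder : ∀ b, ∀ R : ℕ, ⌈ρ b⌉₊ ≤ R → ∀ t ∈ Ico 0 b,
      HasDerivWithinAt (y R) (f (s t) (y R t)) (Ici t) t := by
    intro b R hR t ht
    have := (hy R).hasDerivWithinAt (hg R) ht.1 (h.continuousWithinAt htop ht.1)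
    rwa [hcut b R hR t (Ico_subset_Icc_self ht), one_smul] at this
  have hcont : ∀ R b, ContinuousOn (y R) (Icc 0 b) := fun R b =>
    (hy R).continuousOn.mono Icc_subset_Ici_self
  have hagree : ∀ b, ∀ R : ℕ, ⌈ρ b⌉₊ ≤ R → EqOn (y R) (y ⌈ρ b⌉₊) (Icc 0 b) := fun b R hR =>
    eqOn_Icc_of_hasDerivWithinAt hf (hcont _ _) (hcont _ _) (hder b R hR) (hder b _ le_rfl)
      ((hy _).apply_zero.trans (hy _).apply_zero.symm)
  -- At time `t` the radius is adequate for the horizon `t`. Radii above `ρ b` leave the cutoff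
  -- inactive on `[0, b]`, so their solutions agree there; as `ρ` need not be monotone, two horizons
  -- are compared through the larger radius.
  set x : ℝ → State n := fun t => y ⌈ρ t⌉₊ t with hxdef
  have hxy : ∀ b, EqOn x (y ⌈ρ b⌉₊) (Icc 0 b) := by
    intro b t ht
    have h1 := hagree t (max ⌈ρ t⌉₊ ⌈ρ b⌉₊) (le_max_left _ _) ⟨ht.1, le_rfl⟩
    have h2 := hagree b (max ⌈ρ t⌉₊ ⌈ρ b⌉₊) (le_max_right _ _) ht
    exact h1.symm.trans h2
  have hfield : ∀ b, ∀ u ∈ Icc 0 b,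
      cutoff (⌈ρ b⌉₊ : ℝ) (y ⌈ρ b⌉₊ u) • f (s u) (y ⌈ρ b⌉₊ u) = f (s u) (x u) := by
    intro b u hu
    rw [hcut b _ le_rfl u hu, one_smul, hxy b hu]
  have hfield' : ∀ b, 0 ≤ b → ∀ u ∈ uIoc 0 b,
      cutoff (⌈ρ b⌉₊ : ℝ) (y ⌈ρ b⌉₊ u) • f (s u) (y ⌈ρ b⌉₊ u) = f (s u) (x u) := by
    intro b hb u hu
    rw [uIoc_of_le hb] at hu
    exact hfield b u (Ioc_subset_Icc_self hu)
  refine ⟨x, ⟨?_, fun t ht => ?_, fun t ht => ?_⟩, fun t ht => ?_⟩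
  · intro t ht
    have h1 : ContinuousWithinAt (y ⌈ρ (t + 1)⌉₊) (Ici 0) t := (hy _).continuousOn t ht
    have ht0 : (0 : ℝ) ≤ t := ht
    refine h1.congr_of_eventuallyEq ?_ (hxy (t + 1) ⟨ht0, by linarith⟩)
    filter_upwards [self_mem_nhdsWithin, mem_nhdsWithin_of_mem_nhds (Iio_mem_nhds (lt_add_one t))]
      with u hu hu'
    exact hxy (t + 1) ⟨hu, le_of_lt hu'⟩
  · exact ((hy ⌈ρ t⌉₊).integrable t ht).congr (hfield' t ht)
  · refine ((hy ⌈ρ t⌉₊).integral_eq t ht).trans ?_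
    congr 1
    exact intervalIntegral.integral_congr_ae (Eventually.of_forall (hfield' t ht))
  · refine tendsto_const_nhds.congr' ?_
    filter_upwards [eventually_ge_atTop ⌈ρ t⌉₊] with R hR
    exact (hagree t R hR ⟨ht, le_rfl⟩).symm

/-- A right-continuous process with values in a finite set is jointly measurable. -/
lemma IsSwitchingSignal.measurable_uncurry {σ : ℝ → Ω → Fin N} {τ : ℕ → Ω → ℝ} {σ₀ : Fin N}
    (hσ : IsSwitchingSignal σ τ σ₀) : Measurable fun p : ℝ × Ω => σ (max p.1 0) p.2 := by
  -- Rounding up to the grid of mesh `1 / (k + 1)` gives countably many times converging to `t` from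
  -- the right, where right-continuity applies.
  have hd : ∀ t : ℝ, 0 ≤ t →
      Tendsto (fun k : ℕ => (⌈t * (k + 1)⌉₊ : ℝ) / (k + 1)) atTop (𝓝[≥] t) := by
    intro t ht
    refine tendsto_nhdsWithin_iff.2 ⟨?_, Eventually.of_forall fun k => ?_⟩
    · have h1 : Tendsto (fun k : ℕ => t + 1 / ((k : ℝ) + 1)) atTop (𝓝 t) := by
        simpa using tendsto_const_nhds.add (tendsto_one_div_add_atTop_nhds_zero_nat (𝕜 := ℝ))
      refine tendsto_of_tendsto_of_tendsto_of_le_of_le tendsto_const_nhds h1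
        (fun k => ?_) fun k => ?_
      · have : (0 : ℝ) < k + 1 := by positivity
        exact (le_div_iff₀ this).2 (Nat.le_ceil _)
      · have : (0 : ℝ) < k + 1 := by positivity
        have h2 := (Nat.ceil_lt_add_one (a := t * (k + 1)) (mul_nonneg ht this.le)).le
        simp only
        rw [div_le_iff₀ this, add_mul, one_div, inv_mul_cancel₀ this.ne']
        exact h2
    · have : (0 : ℝ) < k + 1 := by positivity
      exact (le_div_iff₀ this).2 (Nat.le_ceil _)
  refine measurable_of_tendsto_metrizable
    (f := fun (k : ℕ) (p : ℝ × Ω) => σ ((⌈max p.1 0 * (k + 1)⌉₊ : ℝ) / (k + 1)) p.2) (fun k => ?_)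
    (tendsto_pi_nhds.2 fun p => ?_)
  · have h1 : Measurable fun q : ℕ × Ω => σ ((q.1 : ℝ) / (k + 1)) q.2 :=
      measurable_from_prod_countable_right fun m =>
        hσ.measurable_signal _ (show (0 : ℝ) ≤ (m : ℝ) / (k + 1) by positivity)
    have h2 : Measurable fun p : ℝ × Ω => ⌈max p.1 0 * ((k : ℝ) + 1)⌉₊ :=
      Nat.measurable_ceil.comp ((measurable_fst.max measurable_const).mul_const _)
    exact h1.comp (h2.prodMk measurable_snd)
  · have := ((hσ.cadlag p.2).1 (max p.1 0) (le_max_right _ _))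
    exact this.tendsto.comp (hd _ (le_max_right _ _))

lemma IsSwitchingSignal.isPathSwitching {σ : ℝ → Ω → Fin N} {τ : ℕ → Ω → ℝ} {σ₀ : Fin N}
    (hσ : IsSwitchingSignal σ τ σ₀) (ω : Ω) :
    IsPathSwitching (fun t => σ t ω) (fun j => τ j ω) :=
  ⟨hσ.instant_zero ω, hσ.monotone ω, hσ.const_between ω⟩

/-- Evaluation at a random instant calls for joint measurability of the signal. -/
lemma IsSwitchingSignal.measurable_modeAt {σ : ℝ → Ω → Fin N} {τ : ℕ → Ω → ℝ} {σ₀ : Fin N}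
    (hσ : IsSwitchingSignal σ τ σ₀) (j : ℕ) : Measurable (modeAt σ τ j) := by
  have h := hσ.measurable_uncurry.comp ((hσ.measurable_instant j).prodMk measurable_id)
  convert h using 1
  funext ω
  simp [modeAt, max_eq_left ((hσ.isPathSwitching ω).nonneg j)]

/-- Well-posedness of randomly switched systems whose switching instants almost surely do not
accumulate. -/
lemma isWellPosed_of_tendsto {P : Measure Ω} {f : Fin N → State n → State n}
    (hf : ∀ i, LocallyLipschitz (f i)) {V : Fin N → State n → ℝ}
    {α₁ α₂ : ℝ≥0 → ℝ≥0} {μ : ℝ} {lam : Fin N → ℝ} (hV : LyapunovFamily f V α₁ α₂ μ lam)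
    {σ : ℝ → Ω → Fin N} {τ : ℕ → Ω → ℝ} {σ₀ : Fin N} (hσ : IsSwitchingSignal σ τ σ₀)
    (htop : ∀ᵐ ω ∂P, Tendsto (fun j => τ j ω) atTop atTop) : IsWellPosed P f σ := by
  intro x₀
  have hcut : ∀ R : ℕ, ∃ y : ℝ → Ω → State n, (∀ t, Measurable (y t)) ∧
      ∀ ω, IsSolution (fun i z => cutoff R z • f i z) (fun t => σ t ω) x₀ (fun t => y t ω) := by
    intro R
    choose K C hK hC hbd hlip using fun i => exists_lipschitz_cutoff_smul (hf i) R
    obtain ⟨y, hym, hy⟩ := exists_measurable_solution (g := fun i z => cutoff R z • f i z)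
      (K := ∑ i, K i) (C := ∑ i, C i) (Finset.sum_nonneg fun i _ => hK i)
      (Finset.sum_nonneg fun i _ => hC i)
      (fun i x => (hbd i x).trans
        (Finset.single_le_sum (f := C) (fun i _ => hC i) (Finset.mem_univ i)))
      (fun i x y => (hlip i x y).trans (mul_le_mul_of_nonneg_right
        (Finset.single_le_sum (f := K) (fun i _ => hK i) (Finset.mem_univ i)) (norm_nonneg _)))
      (s := fun t ω => σ (max t 0) ω) hσ.measurable_uncurry x₀
    exact ⟨y, hym, fun ω => (hy ω).congr_signal fun t ht => by rw [max_eq_left ht]⟩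
  choose y hym hy using hcut
  -- The conclusion is guarded by non-accumulation, so a path can be chosen for every `ω`; its value
  -- on the null set is irrelevant.
  have hlim : ∀ ω, ∃ x : ℝ → State n, Tendsto (fun j => τ j ω) atTop atTop →
      IsSolution f (fun t => σ t ω) x₀ x ∧
        ∀ t, 0 ≤ t → Tendsto (fun R => y R t ω) atTop (𝓝 (x t)) := by
    intro ω
    by_cases hω : Tendsto (fun j => τ j ω) atTop atTop
    · obtain ⟨x, hx⟩ := exists_solution_of_cutoff hf hV (hσ.isPathSwitching ω) hω x₀
        (y := fun R t => y R t ω) (fun R => hy R ω)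
      exact ⟨x, fun _ => hx⟩
    · exact ⟨0, fun h => absurd h hω⟩
  choose x hx using hlim
  refine ⟨fun t ω => x ω t, ?_, fun t ht => ?_, ?_⟩
  · filter_upwards [htop] with ω hω using (hx ω hω).1
  · refine aemeasurable_of_tendsto_metrizable_ae' (fun R => (hym R t).aemeasurable) ?_
    filter_upwards [htop] with ω hω using (hx ω hω).2 t ht
  · filter_upwards [htop] with ω hω z hz t ht
    have hfc : ∀ i, Continuous (f i) := fun i => (hf i).continuous
    have hd : ∀ {w : ℝ → State n}, IsSolution f (fun t => σ t ω) x₀ w → ∀ u ∈ Ico 0 t,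
        HasDerivWithinAt w (f (σ u ω) (w u)) (Ici u) u := fun hw u hu =>
      hw.hasDerivWithinAt hfc hu.1 ((hσ.isPathSwitching ω).continuousWithinAt hω hu.1)
    have hxs := (hx ω hω).1
    exact eqOn_Icc_of_hasDerivWithinAt hf (hz.continuousOn.mono Icc_subset_Ici_self)
      (hxs.continuousOn.mono Icc_subset_Ici_self) (hd hz) (hd hxs)
      (hz.apply_zero.trans hxs.apply_zero.symm) ⟨ht, le_rfl⟩

end WellPosed

/-! ### Exponential moments of class UH and non-accumulation of switches. -/

section Expectation

variable {Ω : Type*} [MeasurableSpace Ω] {N : ℕ}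

lemma integral_exp_neg_mul (a : ℝ) {T : ℝ} (hT : 0 < T) :
    ∫ x in (0 : ℝ)..T, Real.exp (-a * x) = T * uniformFactor a T := by
  rcases eq_or_ne a 0 with rfl | ha
  · simp [uniformFactor]
  · rw [intervalIntegral.integral_comp_mul_left (fun x => Real.exp x) (neg_ne_zero.2 ha),
      integral_exp, uniformFactor, if_neg ha, mul_zero, Real.exp_zero, smul_eq_mul]
    field_simp
    ring

/-- The factor is the average of a positive function over `[0, T]`, whatever the sign of `a`. -/
lemma uniformFactor_nonneg (a : ℝ) {T : ℝ} (hT : 0 < T) : 0 ≤ uniformFactor a T := by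
  have h : 0 ≤ T * uniformFactor a T := integral_exp_neg_mul a hT ▸
    intervalIntegral.integral_nonneg hT.le fun x _ => (Real.exp_pos _).le
  exact nonneg_of_mul_nonneg_right h hT

lemma uniformFactor_one_lt_one {T : ℝ} (hT : 0 < T) : uniformFactor 1 T < 1 := by
  rw [uniformFactor, if_neg one_ne_zero, one_mul, div_lt_one hT]
  have := Real.add_one_lt_exp (x := -1 * T) (by simpa using hT.ne')
  linarith

/-- The Laplace transform of the uniform distribution on `[0, T]`. -/
lemma lintegral_exp_of_isUniform {P : Measure Ω} {X : Ω → ℝ} (hX : Measurable X) {T : ℝ}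
    (hT : 0 < T) (hU : pdf.IsUniform X (Icc 0 T) P volume) (a : ℝ) :
    ∫⁻ ω, ENNReal.ofReal (Real.exp (-a * X ω)) ∂P = ENNReal.ofReal (uniformFactor a T) := by
  have hc : Continuous fun x : ℝ => Real.exp (-a * x) := by fun_prop
  rw [← lintegral_map (f := fun x => ENNReal.ofReal (Real.exp (-a * x)))
    (ENNReal.measurable_ofReal.comp hc.measurable) hX, hU, ProbabilityTheory.cond,
    lintegral_smul_measure, ← ofReal_integral_eq_lintegral_ofReal hc.integrableOn_Icc
      (Eventually.of_forall fun x => (Real.exp_pos _).le), integral_Icc_eq_integral_Ioc,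
    ← intervalIntegral.integral_of_le hT.le, integral_exp_neg_mul a hT, Real.volume_Icc, sub_zero,
    ENNReal.ofReal_mul hT.le, smul_eq_mul, ← mul_assoc,
    ENNReal.inv_mul_cancel (by simpa using hT) ENNReal.ofReal_ne_top, one_mul]

lemma ae_mem_of_isUniform {P : Measure Ω} {X : Ω → ℝ} (hX : Measurable X) {T : ℝ}
    (hU : pdf.IsUniform X (Icc 0 T) P volume) : ∀ᵐ ω ∂P, X ω ∈ Icc 0 T := by
  refine ae_of_ae_map (p := fun x => x ∈ Icc 0 T) hX.aemeasurable ?_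
  rw [hU]
  exact ae_cond_mem measurableSet_Icc

/-- Integrating out an independent sequence from a product along a random word. -/
lemma lintegral_prod_of_indepFun {P : Measure Ω} [IsProbabilityMeasure P] {S : ℕ → Ω → ℝ}
    {m : ℕ → Ω → Fin N} (hS : ∀ k, Measurable (S k)) (hm : ∀ k, Measurable (m k))
    (hSi : iIndepFun S P) (hSm : IndepFun (fun ω k => S k ω) (fun ω k => m k ω) P)
    {h : Fin N → ℝ → ℝ≥0∞} (hh : ∀ i, Measurable (h i)) {c : Fin N → ℝ≥0∞}
    (hc : ∀ i k, ∫⁻ ω, h i (S k ω) ∂P = c i) (j : ℕ) :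
    ∫⁻ ω, ∏ k ∈ Finset.range j, h (m k ω) (S k ω) ∂P =
      ∫⁻ ω, ∏ k ∈ Finset.range j, c (m k ω) ∂P := by
  have hSm' : Measurable fun ω k => S k ω := measurable_pi_lambda _ hS
  have hmm' : Measurable fun ω k => m k ω := measurable_pi_lambda _ hm
  have hh' : Measurable fun p : Fin N × ℝ => h p.1 p.2 := measurable_from_prod_countable_right hh
  have hΦ : Measurable fun p : (ℕ → ℝ) × (ℕ → Fin N) =>
      ∏ k ∈ Finset.range j, h (p.2 k) (p.1 k) :=
    Finset.measurable_fun_prod _ fun k _ => hh'.comp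
      (f := fun p : (ℕ → ℝ) × (ℕ → Fin N) => (p.2 k, p.1 k)) (by fun_prop)
  have hc' : Measurable fun w : ℕ → Fin N => ∏ k ∈ Finset.range j, c (w k) :=
    Finset.measurable_fun_prod _ fun k _ =>
      (measurable_of_countable c).comp (measurable_pi_apply k)
  have : IsProbabilityMeasure (P.map fun ω k => S k ω) :=
    Measure.isProbabilityMeasure_map hSm'.aemeasurable
  have : IsProbabilityMeasure (P.map fun ω k => m k ω) :=
    Measure.isProbabilityMeasure_map hmm'.aemeasurable
  -- By independence the joint law is a product, so the word of modes can be frozen; the product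
  -- then factorises over the independent holding times. Nothing is required of the law of the
  -- modes.
  calc ∫⁻ ω, ∏ k ∈ Finset.range j, h (m k ω) (S k ω) ∂P
      = ∫⁻ p, ∏ k ∈ Finset.range j, h (p.2 k) (p.1 k)
          ∂(P.map fun ω => ((fun k => S k ω), (fun k => m k ω))) :=
        (lintegral_map hΦ (hSm'.prodMk hmm')).symm
    _ = ∫⁻ w, ∫⁻ s, ∏ k ∈ Finset.range j, h (w k) (s k) ∂(P.map fun ω k => S k ω)
          ∂(P.map fun ω k => m k ω) := by
        rw [(indepFun_iff_map_prod_eq_prod_map_map hSm'.aemeasurable hmm'.aemeasurable).1 hSm,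
          lintegral_prod_symm' _ hΦ]
    _ = ∫⁻ w, ∏ k ∈ Finset.range j, c (w k) ∂(P.map fun ω k => m k ω) := by
        refine lintegral_congr fun w => ?_
        have hw : Measurable fun s : ℕ → ℝ => ∏ k ∈ Finset.range j, h (w k) (s k) :=
          hΦ.comp (measurable_id.prodMk measurable_const)
        rw [lintegral_map hw hSm',
          lintegral_prod_eq_prod_lintegral_of_indepFun (Finset.range j)
            (fun k ω => h (w k) (S k ω)) (hSi.comp (fun k => h (w k)) fun k => hh _)
            fun k => (hh _).comp (hS k)]
        exact Finset.prod_congr rfl fun k _ => hc _ _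
    _ = _ := lintegral_map hc' hmm'

/-- An event with constant conditional probability decouples from the conditioning σ-algebra. -/
lemma setLIntegral_eq_of_condExp_const {α : Type*} {m m₀ : MeasurableSpace α}
    {P : Measure α} [IsProbabilityMeasure P] (hm : m ≤ m₀) {B : Set α}
    (hB : MeasurableSet B) {c : ℝ} (hc : P⟦B | m⟧ =ᵐ[P] fun _ => c) {Z : α → ℝ≥0∞}
    (hZ : Measurable[m] Z) : ∫⁻ ω in B, Z ω ∂P = ENNReal.ofReal c * ∫⁻ ω, Z ω ∂P := by
  -- On `m` the measures `P.restrict B` and `c • P` coincide, so they integrate every `m`-measurable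
  -- `Z` alike, without integrability.
  have hmeas : (P.restrict B).trim hm = (ENNReal.ofReal c • P).trim hm := by
    refine @Measure.ext _ m _ _ fun A hA => ?_
    have hA' : MeasurableSet A := hm A hA
    rw [trim_measurableSet_eq hm hA, trim_measurableSet_eq hm hA, Measure.restrict_apply hA',
      Measure.smul_apply, smul_eq_mul]
    have h1 : ∫ ω in A, (P⟦B | m⟧) ω ∂P = ∫ ω in A, B.indicator (fun _ => (1 : ℝ)) ω ∂P :=
      setIntegral_condExp hm ((integrable_const _).indicator hB) hA
    rw [setIntegral_congr_ae hA' (hc.mono fun ω h _ => h), setIntegral_const,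
      setIntegral_indicator hB, setIntegral_const, smul_eq_mul, smul_eq_mul, mul_one] at h1
    rw [← ENNReal.ofReal_toReal (measure_ne_top P (A ∩ B)),
      ← ENNReal.ofReal_toReal (measure_ne_top P A), mul_comm,
      ← ENNReal.ofReal_mul ENNReal.toReal_nonneg]
    exact congrArg ENNReal.ofReal h1.symm
  rw [← lintegral_trim hm hZ, hmeas, lintegral_trim hm hZ, lintegral_smul_measure, smul_eq_mul]

/-- Expectation of a product along the sequence of modes. -/
lemma lintegral_prod_modes {P : Measure Ω} [IsProbabilityMeasure P] {m : ℕ → Ω → Fin N}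
    (hm : ∀ k, Measurable (m k)) {i₀ : Fin N} (h0 : ∀ ω, m 0 ω = i₀) {q : Fin N → ℝ}
    (hq : ∀ j, 1 ≤ j → ∀ i, P⟦m j ⁻¹' {i} | ⨆ k : Fin j,
      MeasurableSpace.comap (m k) inferInstance⟧ =ᵐ[P] fun _ => q i)
    (c : Fin N → ℝ≥0∞) (j : ℕ) :
    ∫⁻ ω, ∏ k ∈ Finset.range (j + 1), c (m k ω) ∂P =
      c i₀ * (∑ i, ENNReal.ofReal (q i) * c i) ^ j := by
  induction j with
  | zero => simp [h0]
  | succ j ih =>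
    have hle : (⨆ k : Fin (j + 1), MeasurableSpace.comap (m k) inferInstance) ≤
        ‹MeasurableSpace Ω› := iSup_le fun k => (hm k).comap_le
    have hZ : Measurable[⨆ k : Fin (j + 1), MeasurableSpace.comap (m k) inferInstance]
        fun ω => ∏ k ∈ Finset.range (j + 1), c (m k ω) := by
      refine Finset.measurable_fun_prod _ fun k hk => (measurable_of_countable c).comp ?_
      exact (comap_measurable (m k)).mono
        (le_iSup (fun k : Fin (j + 1) => MeasurableSpace.comap (m k) inferInstance)
          ⟨k, Finset.mem_range.1 hk⟩) le_rfl
    have hB : ∀ i, MeasurableSet (m (j + 1) ⁻¹' {i}) := fun i =>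
      hm (j + 1) (measurableSet_singleton i)
    -- Partition by the last mode: the remaining product depends only on the earlier ones, from
    -- which that event decouples.
    have hsplit : ∀ ω, ∏ k ∈ Finset.range (j + 2), c (m k ω) =
        ∑ i, (m (j + 1) ⁻¹' {i}).indicator
          (fun ω => c i * ∏ k ∈ Finset.range (j + 1), c (m k ω)) ω := by
      intro ω
      rw [Finset.prod_range_succ, Finset.sum_eq_single (m (j + 1) ω), mul_comm,
        indicator_of_mem (by simp)]
      · intro i _ hi
        exact indicator_of_notMem (by simpa using hi.symm) _
      · simp
    have hZ' := hZ.mono hle le_rfl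
    calc ∫⁻ ω, ∏ k ∈ Finset.range (j + 2), c (m k ω) ∂P
        = ∑ i, ∫⁻ ω in m (j + 1) ⁻¹' {i}, c i * ∏ k ∈ Finset.range (j + 1), c (m k ω) ∂P := by
          simp_rw [hsplit]
          rw [lintegral_finsetSum _ fun i _ => (hZ'.const_mul _).indicator (hB i)]
          exact Finset.sum_congr rfl fun i _ => lintegral_indicator (hB i) _
      _ = ∑ i, c i * (ENNReal.ofReal (q i) *
            ∫⁻ ω, ∏ k ∈ Finset.range (j + 1), c (m k ω) ∂P) := by
          refine Finset.sum_congr rfl fun i _ => ?_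
          rw [lintegral_const_mul _ hZ', setLIntegral_eq_of_condExp_const hle (hB i)
            (hq (j + 1) (by omega) i) hZ]
      _ = _ := by
          rw [ih, pow_succ, ← mul_assoc, Finset.mul_sum]
          exact Finset.sum_congr rfl fun i _ => by ring

variable {P : Measure Ω} [IsProbabilityMeasure P] {σ : ℝ → Ω → Fin N} {τ : ℕ → Ω → ℝ}
  {σ₀ : Fin N} {T : ℝ} {q : Fin N → ℝ}

lemma IsSwitchingSignal.measurable_holdingTime (hσ : IsSwitchingSignal σ τ σ₀) (j : ℕ) :
    Measurable (holdingTime τ j) := (hσ.measurable_instant _).sub (hσ.measurable_instant _)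

lemma IsSwitchingSignal.modeAt_zero (hσ : IsSwitchingSignal σ τ σ₀) (ω : Ω) :
    modeAt σ τ 0 ω = σ₀ := by
  rw [modeAt, hσ.instant_zero, hσ.init]

/-- Exponential moments of the class UH. -/
lemma IsClassUH.lintegral_prod_exp (hUH : IsClassUH P σ τ T q) (hσ : IsSwitchingSignal σ τ σ₀)
    (a : Fin N → ℝ) (j : ℕ) :
    ∫⁻ ω, ∏ k ∈ Finset.range (j + 1),
        ENNReal.ofReal (Real.exp (-a (modeAt σ τ k ω) * holdingTime τ k ω)) ∂P =
      ENNReal.ofReal (uniformFactor (a σ₀) T) *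
        ENNReal.ofReal (∑ i, q i * uniformFactor (a i) T) ^ j := by
  rw [lintegral_prod_of_indepFun (h := fun i s => ENNReal.ofReal (Real.exp (-a i * s)))
    (c := fun i => ENNReal.ofReal (uniformFactor (a i) T)) hσ.measurable_holdingTime
    hσ.measurable_modeAt hUH.indep_holding hUH.indep_seq (fun i => by fun_prop)
    (fun i k => lintegral_exp_of_isUniform (hσ.measurable_holdingTime k) hUH.T_pos
      (hUH.uniform_holding k) (a i)),
    lintegral_prod_modes hσ.measurable_modeAt hσ.modeAt_zero hUH.cond_mode
      (fun i => ENNReal.ofReal (uniformFactor (a i) T)),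
    ENNReal.ofReal_sum_of_nonneg fun i _ =>
      mul_nonneg (hUH.q_mem i).1 (uniformFactor_nonneg _ hUH.T_pos)]
  simp_rw [fun i => ENNReal.ofReal_mul (q := uniformFactor (a i) T) (hUH.q_mem i).1]

/-- With all weights equal to one, the formula for products of modes computes the total mass both as
`1` and as `∑ i, q i`. -/
lemma IsClassUH.sum_q (hUH : IsClassUH P σ τ T q) (hσ : IsSwitchingSignal σ τ σ₀) :
    ∑ i, q i = 1 := by
  have h := lintegral_prod_modes hσ.measurable_modeAt hσ.modeAt_zero hUH.cond_mode 1 1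
  simp only [Pi.one_apply, Finset.prod_const_one, lintegral_const, measure_univ, mul_one,
    one_mul, pow_one] at h
  rw [← ENNReal.ofReal_sum_of_nonneg fun i _ => (hUH.q_mem i).1] at h
  exact ENNReal.ofReal_eq_one.1 h.symm

lemma tsum_ofReal_pow_ne_top {θ : ℝ} (hθ : θ < 1) : ∑' j : ℕ, ENNReal.ofReal θ ^ j ≠ ∞ := by
  rw [ENNReal.tsum_geometric]
  exact ENNReal.inv_ne_top.2 (tsub_pos_of_lt (by simpa using hθ)).ne'

/-- Almost surely the switching instants do not accumulate. -/
lemma IsClassUH.ae_tendsto_atTop (hUH : IsClassUH P σ τ T q) (hσ : IsSwitchingSignal σ τ σ₀) :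
    ∀ᵐ ω ∂P, Tendsto (fun j => τ j ω) atTop atTop := by
  have hprod : ∀ j ω, ∏ k ∈ Finset.range j,
      ENNReal.ofReal (Real.exp (-1 * holdingTime τ k ω)) =
        ENNReal.ofReal (Real.exp (-τ j ω)) := by
    intro j ω
    rw [← ENNReal.ofReal_prod_of_nonneg fun _ _ => (Real.exp_pos _).le, ← Real.exp_sum,
      ← Finset.mul_sum]
    simp_rw [holdingTime]
    rw [Finset.sum_range_sub (fun k => τ k ω), hσ.instant_zero, sub_zero, neg_one_mul]
  have hexp : ∀ j, Measurable fun ω => ENNReal.ofReal (Real.exp (-τ (j + 1) ω)) := fun j =>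
    (hσ.measurable_instant (j + 1)).neg.exp.ennreal_ofReal
  -- A finite expectation makes the series almost surely finite, so its terms vanish and `τ j` tends
  -- to infinity.
  have hint : ∫⁻ ω, ∑' j, ENNReal.ofReal (Real.exp (-τ (j + 1) ω)) ∂P ≠ ∞ := by
    rw [lintegral_tsum fun j => (hexp j).aemeasurable]
    have h : ∀ j, ∫⁻ ω, ENNReal.ofReal (Real.exp (-τ (j + 1) ω)) ∂P =
        ENNReal.ofReal (uniformFactor 1 T) * ENNReal.ofReal (uniformFactor 1 T) ^ j := by
      intro j
      simp_rw [← hprod]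
      rw [hUH.lintegral_prod_exp hσ (fun _ => 1) j, ← Finset.sum_mul, hUH.sum_q hσ, one_mul]
    simp_rw [h]
    rw [ENNReal.tsum_mul_left]
    exact ENNReal.mul_ne_top ENNReal.ofReal_ne_top
      (tsum_ofReal_pow_ne_top (uniformFactor_one_lt_one hUH.T_pos))
  have hmeas : Measurable fun ω => ∑' j, ENNReal.ofReal (Real.exp (-τ (j + 1) ω)) :=
    Measurable.tsum hexp
  filter_upwards [ae_lt_top hmeas hint] with ω hω
  have h1 := ENNReal.tendsto_atTop_zero_of_tsum_ne_top hω.ne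
  have h2 : Tendsto (fun j => Real.exp (-τ (j + 1) ω)) atTop (𝓝 0) := by
    have := (ENNReal.tendsto_toReal ENNReal.zero_ne_top).comp h1
    simpa [Function.comp_def, ENNReal.toReal_ofReal (Real.exp_pos _).le] using this
  rw [Real.tendsto_exp_comp_nhds_zero, tendsto_neg_atBot_iff] at h2
  exact (tendsto_add_atTop_iff_nat 1).1 h2

end Expectation

/-! ### Summable growth factors and stability in the mean. -/

section MeanStability

variable {Ω : Type*} [MeasurableSpace Ω] {P : Measure Ω} [IsProbabilityMeasure P] {n N : ℕ}
  {σ : ℝ → Ω → Fin N} {τ : ℕ → Ω → ℝ} {σ₀ : Fin N} {T : ℝ} {q : Fin N → ℝ}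

lemma growthFactor_nonneg {μ : ℝ} (hμ : 0 ≤ μ) (lam : Fin N → ℝ) (s : ℝ → Fin N) (r : ℕ → ℝ)
    (j : ℕ) : 0 ≤ growthFactor μ lam s r j :=
  mul_nonneg (pow_nonneg hμ j) (Finset.prod_nonneg fun _ _ => (Real.exp_pos _).le)

lemma ofReal_growthFactor {α : Type*} {σ : ℝ → α → Fin N} {τ : ℕ → α → ℝ} {μ : ℝ} (hμ : 0 ≤ μ)
    (lam : Fin N → ℝ) (j : ℕ) (ω : α) :
    ENNReal.ofReal (growthFactor μ lam (fun t => σ t ω) (fun k => τ k ω) j) =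
      ENNReal.ofReal μ ^ j * ∏ k ∈ Finset.range j,
        ENNReal.ofReal (Real.exp (-lam (modeAt σ τ k ω) * holdingTime τ k ω)) := by
  rw [growthFactor, ENNReal.ofReal_mul (pow_nonneg hμ j), ENNReal.ofReal_pow hμ,
    ENNReal.ofReal_prod_of_nonneg fun _ _ => (Real.exp_pos _).le]
  rfl

lemma measurable_prod_exp (hσ : IsSwitchingSignal σ τ σ₀) (lam : Fin N → ℝ) (j : ℕ) :
    Measurable fun ω => ∏ k ∈ Finset.range j,
      ENNReal.ofReal (Real.exp (-lam (modeAt σ τ k ω) * holdingTime τ k ω)) :=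
  Finset.measurable_fun_prod _ fun k _ => (Measurable.mul
    ((measurable_of_countable fun i => -lam i).comp (hσ.measurable_modeAt k))
    (hσ.measurable_holdingTime k)).exp.ennreal_ofReal

/-- The expected growth factors are summable under the averaged contraction condition. -/
lemma IsClassUH.tsum_lintegral_growthFactor_ne_top (hUH : IsClassUH P σ τ T q)
    (hσ : IsSwitchingSignal σ τ σ₀) {μ : ℝ} (hμ : 0 ≤ μ) {lam : Fin N → ℝ}
    (hsum : ∑ i, μ * q i * uniformFactor (lam i) T < 1) :
    ∑' j, ∫⁻ ω, ENNReal.ofReal (growthFactor μ lam (fun t => σ t ω) (fun k => τ k ω) j) ∂P ≠ ∞ := by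
  -- The moment formula needs at least one holding interval, so index `0` is split off. The
  -- deterministic initial mode contributes a constant outside the geometric ratio.
  rw [tsum_eq_zero_add' ENNReal.summable]
  refine ENNReal.add_ne_top.2 ⟨by simp [growthFactor], ?_⟩
  have h : ∀ j, ∫⁻ ω, ENNReal.ofReal
      (growthFactor μ lam (fun t => σ t ω) (fun k => τ k ω) (j + 1)) ∂P =
        ENNReal.ofReal μ * ENNReal.ofReal (uniformFactor (lam σ₀) T) *
          ENNReal.ofReal (∑ i, μ * q i * uniformFactor (lam i) T) ^ j := by
    intro j
    simp_rw [ofReal_growthFactor hμ]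
    rw [lintegral_const_mul _ (measurable_prod_exp hσ lam _), hUH.lintegral_prod_exp hσ]
    simp_rw [mul_assoc]
    rw [← Finset.mul_sum, ENNReal.ofReal_mul hμ, mul_pow, pow_succ]
    ring
  simp_rw [h]
  rw [ENNReal.tsum_mul_left]
  exact ENNReal.mul_ne_top (ENNReal.mul_ne_top ENNReal.ofReal_ne_top ENNReal.ofReal_ne_top)
    (tsum_ofReal_pow_ne_top hsum)

/-- Mean bounds for solution processes by tails of one convergent series. -/
lemma exists_meanOf_le {f : Fin N → State n → State n} (hf : ∀ i, Continuous (f i))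
    {V : Fin N → State n → ℝ} {α₁ α₂ : ℝ≥0 → ℝ≥0} {μ : ℝ} {lam : Fin N → ℝ}
    (hV : LyapunovFamily f V α₁ α₂ μ lam) (hσ : IsSwitchingSignal σ τ σ₀)
    (hUH : IsClassUH P σ τ T q) (hsum : ∑ i, μ * q i * uniformFactor (lam i) T < 1) :
    ∃ G : ℕ → ℝ≥0∞, ∑' j, G j ≠ ∞ ∧ ∀ (x₀ : State n) (X : ℝ → Ω → State n),
      IsSolutionProcess P f σ x₀ X → ∀ (k : ℕ) (t : ℝ), k * T ≤ t →
        meanOf P α₁ (X t) ≤ α₂ ‖x₀‖₊ * ∑' j, G (j + k) := by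
  have hμ : 0 ≤ μ := zero_le_one.trans hV.one_lt.le
  set L := ∑ i, |lam i|
  have hL : ∀ i, -lam i ≤ L := fun i => (neg_le_abs _).trans
    (Finset.single_le_sum (f := fun i => |lam i|) (fun _ _ => abs_nonneg _) (Finset.mem_univ i))
  have hL0 : 0 ≤ L := Finset.sum_nonneg fun _ _ => abs_nonneg _
  set W : ℕ → Ω → ℝ := fun j ω => growthFactor μ lam (fun t => σ t ω) (fun k => τ k ω) j with hW
  have hWm : ∀ j, Measurable fun ω => ENNReal.ofReal (W j ω) := by
    intro j
    simp_rw [hW, ofReal_growthFactor hμ]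
    exact (measurable_prod_exp hσ lam j).const_mul _
  -- The factor `exp (L * T)` pays for the unfinished last interval, of length at most `T` and
  -- growth rate at most `L`.
  refine ⟨fun j => ENNReal.ofReal (Real.exp (L * T)) * ∫⁻ ω, ENNReal.ofReal (W j ω) ∂P, ?_, ?_⟩
  · rw [ENNReal.tsum_mul_left]
    exact ENNReal.mul_ne_top ENNReal.ofReal_ne_top
      (hUH.tsum_lintegral_growthFactor_ne_top hσ hμ hsum)
  intro x₀ X hX k t ht
  have ht0 : 0 ≤ t := (mul_nonneg k.cast_nonneg hUH.T_pos.le).trans ht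
  calc meanOf P α₁ (X t)
      ≤ ∫⁻ ω, α₂ ‖x₀‖₊ * (ENNReal.ofReal (Real.exp (L * T)) *
          ∑' j, ENNReal.ofReal (W (j + k) ω)) ∂P := by
        refine lintegral_mono_ae ?_
        filter_upwards [hX, hUH.ae_tendsto_atTop hσ, ae_all_iff.2 fun j =>
          ae_mem_of_isUniform (hσ.measurable_holdingTime j) (hUH.uniform_holding j)]
          with ω hXω htop hhold
        have hpath := hσ.isPathSwitching ω
        obtain ⟨j, hj⟩ := hpath.exists_mem_Ico htop ht0
        -- Since `τ (j + 1) ≤ (j + 1) * T`, a time `t ≥ k * T` before `τ (j + 1)` forces `k ≤ j`.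
        have hτ : ∀ i : ℕ, τ i ω ≤ i * T := by
          intro i
          induction i with
          | zero => simp [hσ.instant_zero]
          | succ i ih =>
            have := (hhold i).2
            rw [holdingTime] at this
            push_cast
            linarith
        have hkj : k ≤ j := by
          have h1 : (k : ℝ) * T < (j + 1 : ℕ) * T := ht.trans_lt (hj.2.trans_le (hτ (j + 1)))
          exact Nat.lt_succ_iff.1 (by exact_mod_cast lt_of_mul_lt_mul_right h1 hUH.T_pos.le)
        have hbound := hpath.lyapunov_le hV.differentiable hV.lie_le hμ hV.compare hXω.continuousOn
          (fun u hu => hXω.hasDerivWithinAt hf hu (hpath.continuousWithinAt htop hu)) j t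
          (Ico_subset_Icc_self hj)
        have hexp : Real.exp (-lam (σ (τ j ω) ω) * (t - τ j ω)) ≤ Real.exp (L * T) := by
          have h1 : t - τ j ω ≤ T := by
            have := (hhold j).2
            rw [holdingTime] at this
            linarith [hj.2]
          have h2 : 0 ≤ t - τ j ω := sub_nonneg.2 hj.1
          exact Real.exp_le_exp.2 ((mul_le_mul_of_nonneg_right (hL _) h2).trans
            (mul_le_mul_of_nonneg_left h1 hL0))
        have hWj : 0 ≤ W j ω := growthFactor_nonneg hμ _ _ _ _
        have hreal : (α₁ ‖X t ω‖₊ : ℝ) ≤ α₂ ‖x₀‖₊ * (Real.exp (L * T) * W j ω) := by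
          refine (hV.lower _ _).trans (hbound.trans ?_)
          rw [hXω.apply_zero]
          calc _ ≤ Real.exp (L * T) * (W j ω * α₂ ‖x₀‖₊) := by
                have := hV.nonneg (σ 0 ω) x₀
                gcongr
                exact hV.upper _ _
            _ = _ := by ring
        calc (α₁ ‖X t ω‖₊ : ℝ≥0∞) = ENNReal.ofReal (α₁ ‖X t ω‖₊ : ℝ) :=
              ENNReal.ofReal_coe_nnreal.symm
          _ ≤ ENNReal.ofReal (α₂ ‖x₀‖₊ * (Real.exp (L * T) * W j ω)) :=
              ENNReal.ofReal_le_ofReal hreal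
          _ = α₂ ‖x₀‖₊ * (ENNReal.ofReal (Real.exp (L * T)) * ENNReal.ofReal (W j ω)) := by
              rw [ENNReal.ofReal_mul (NNReal.coe_nonneg _), ENNReal.ofReal_coe_nnreal,
                ENNReal.ofReal_mul (Real.exp_pos _).le]
          _ ≤ _ := by
              gcongr
              have := ENNReal.le_tsum (f := fun i => ENNReal.ofReal (W (i + k) ω)) (j - k)
              simpa [Nat.sub_add_cancel hkj] using this
    _ = α₂ ‖x₀‖₊ * ∑' j, ENNReal.ofReal (Real.exp (L * T)) *
          ∫⁻ ω, ENNReal.ofReal (W (j + k) ω) ∂P := by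
        have hm : Measurable fun ω => ∑' j, ENNReal.ofReal (W (j + k) ω) :=
          Measurable.tsum fun j => hWm (j + k)
        rw [lintegral_const_mul _ (hm.const_mul _), lintegral_const_mul _ hm,
          lintegral_tsum fun j => (hWm _).aemeasurable, ENNReal.tsum_mul_left]

/-- Global asymptotic stability in the mean under the averaged contraction condition. -/
lemma isGASMean_of_isClassUH {f : Fin N → State n → State n} (hf : ∀ i, Continuous (f i))
    {V : Fin N → State n → ℝ} {α₁ α₂ : ℝ≥0 → ℝ≥0} {μ : ℝ} {lam : Fin N → ℝ}
    (hV : LyapunovFamily f V α₁ α₂ μ lam) (hσ : IsSwitchingSignal σ τ σ₀)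
    (hUH : IsClassUH P σ τ T q) (hsum : ∑ i, μ * q i * uniformFactor (lam i) T < 1) :
    IsGASMean P f σ α₁ := by
  obtain ⟨G, hG, hbound⟩ := exists_meanOf_le hf hV hσ hUH hsum
  refine ⟨fun ε hε => ?_, fun r ε hr hε => ?_⟩
  · have hcont : Continuous fun x : State n => (α₂ ‖x‖₊ : ℝ≥0∞) :=
      ENNReal.continuous_coe.comp (hV.upper_classKInf.continuous.comp continuous_nnnorm)
    have hlim : Tendsto (fun x : State n => (α₂ ‖x‖₊ : ℝ≥0∞) * ∑' j, G j) (𝓝 0) (𝓝 0) := by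
      have := ENNReal.Tendsto.mul_const (hcont.tendsto 0) (Or.inr hG)
      simpa [hV.upper_classKInf.map_zero] using this
    obtain ⟨δ, hδ, hball⟩ := Metric.eventually_nhds_iff.1
      (hlim.eventually_lt_const (ENNReal.ofReal_pos.2 hε))
    refine ⟨δ, hδ, fun x₀ hx₀ X hX => lt_of_le_of_lt ?_ (hball (by simpa using hx₀))⟩
    -- Taking `k = 0` keeps the whole series and allows every `t ≥ 0`.
    exact iSup₂_le fun t ht => by simpa using hbound x₀ X hX 0 t (by simpa using ht)
  · have hlim : Tendsto (fun k => (α₂ r.toNNReal : ℝ≥0∞) * ∑' j, G (j + k)) atTop (𝓝 0) := by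
      have := ENNReal.Tendsto.const_mul (a := (α₂ r.toNNReal : ℝ≥0∞))
        (ENNReal.tendsto_sum_nat_add G hG) (Or.inr ENNReal.coe_ne_top)
      simpa using this
    obtain ⟨k, hk⟩ := (hlim.eventually_lt_const (ENNReal.ofReal_pos.2 hε)).exists
    refine ⟨k * T, mul_nonneg k.cast_nonneg hUH.T_pos.le, fun x₀ hx₀ X hX => lt_of_le_of_lt ?_ hk⟩
    refine iSup₂_le fun t ht => (hbound x₀ X hX k t ht).trans ?_
    gcongr
    refine hV.upper_classKInf.strictMono.monotone ?_
    rw [← NNReal.coe_le_coe, coe_nnnorm, Real.coe_toNNReal r hr.le]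
    exact hx₀.le

end MeanStability

end SwitchedSystem

theorem mainTheorem5 {Ω : Type*} [MeasurableSpace Ω] (P : Measure Ω) [IsProbabilityMeasure P]
    {n N : ℕ} (f : Fin N → SwitchedSystem.State n → SwitchedSystem.State n)
    (hf_lip : ∀ i, LocallyLipschitz (f i)) (hf_zero : ∀ i, f i 0 = 0)
    (σ : ℝ → Ω → Fin N) (τ : ℕ → Ω → ℝ) (σ₀ : Fin N)
    (hσ : SwitchedSystem.IsSwitchingSignal σ τ σ₀)
    (V : Fin N → SwitchedSystem.State n → ℝ) (α₁ α₂ : ℝ≥0 → ℝ≥0) (μ : ℝ) (lam : Fin N → ℝ)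
    (hV : SwitchedSystem.LyapunovFamily f V α₁ α₂ μ lam)
    (T : ℝ) (q : Fin N → ℝ)
    (hUH : SwitchedSystem.IsClassUH P σ τ T q)
    (hsum : ∑ i, μ * q i * SwitchedSystem.uniformFactor (lam i) T < 1) :
    SwitchedSystem.IsWellPosed P f σ ∧ SwitchedSystem.IsGASMean P f σ α₁ :=
  ⟨SwitchedSystem.isWellPosed_of_tendsto hf_lip hV hσ (hUH.ae_tendsto_atTop hσ),
    SwitchedSystem.isGASMean_of_isClassUH (fun i => (hf_lip i).continuous) hV hσ hUH hsum⟩
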